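/- Let $W=\{W(u,v)\}_{u,v\ge 0}$ be a standard real-valued two-parameter Brownian sheet on a probability space $(\Omega,\mathcal F,\mathrm P)$, i.e. a centred Gaussian process with $\mathrm E[W(s,t)W(u,v)]=\min(s,u)\min(t,v)$ for all $s,t,u,v\ge 0$ and with almost surely continuous sample functions $(u,v)\mapsto W(u,v)$. For $s,t>0$ set $$\mathfrak G(s,t):=\bigcap_{\varepsilon\in\mathbb Q,\ \varepsilon>0}\sigma\Big\{W(u,v)-W(s,t):\ u,v\ge 0,\ \max(|s-u|,|t-v|)<\varepsilon\Big\}.$$ Then for all fixed $s,t>0$ the $\sigma$-algebra $\mathfrak G(s,t)$ is trivial: $\mathrm P(A)\in\{0,1\}$ for every $A\in\mathfrak G(s,t)$. -/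

import Mathlib

open MeasureTheory ProbabilityTheory
open scoped NNReal

namespace BrownianSheet

/-- The (real-valued, two-parameter, standard) Brownian sheet on the probability space `(Ω, P)`:
a centred Gaussian process indexed by the closed quadrant, with covariance
`E[W(s,t) W(u,v)] = min(s,u) min(t,v)` and almost surely continuous sample functions. -/
structure IsBrownianSheet {Ω : Type*} [MeasurableSpace Ω]
    (W : ℝ≥0 × ℝ≥0 → Ω → ℝ) (P : Measure Ω) : Prop where
  measurable : ∀ p, Measurable (W p)
  isGaussianProcess : IsGaussianProcess W P
  integral_eq_zero : ∀ p, ∫ ω, W p ω ∂P = 0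
  covariance_eq : ∀ p q,
    cov[W p, W q; P] = min (p.1 : ℝ) (q.1 : ℝ) * min (p.2 : ℝ) (q.2 : ℝ)
  continuous_paths : ∀ᵐ ω ∂P, Continuous fun p ↦ W p ω

/-- The σ-algebra on `Ω` generated by the random variables `W(u,v) - W(s,t)`, where `(u,v)`
ranges over the points of the quadrant at `ℓ^∞`-distance less than `ε` from `(s,t)`. -/
abbrev incrementSigma {Ω : Type*} (W : ℝ≥0 × ℝ≥0 → Ω → ℝ) (s t : ℝ≥0) (ε : ℝ) :
    MeasurableSpace Ω :=
  ⨆ q : {q : ℝ≥0 × ℝ≥0 // max |(s : ℝ) - q.1| |(t : ℝ) - q.2| < ε},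
    MeasurableSpace.comap (fun ω ↦ W q ω - W (s, t) ω) (borel ℝ)

/-- The germ σ-algebra at `(s,t)`: the intersection of the σ-algebras `incrementSigma W s t ε`
over the strictly positive rationals `ε`. -/
abbrev germSigma {Ω : Type*} (W : ℝ≥0 × ℝ≥0 → Ω → ℝ) (s t : ℝ≥0) : MeasurableSpace Ω :=
  ⨅ ε : {ε : ℚ // 0 < ε}, incrementSigma W s t ((ε : ℚ) : ℝ)

end BrownianSheet

/-! Delete from `[0,p]` the strips of half-width `δ` about the two axis-parallel lines through
`(s,t)`. The white noise of what remains (`puncturedSheet`) has the same covariance with `W q` for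
every `q` within `δ` of `(s,t)`, hence none with the increments `W q - W (s,t)`; by joint
Gaussianity it is independent of them. As `δ → 0` it converges to `W p` by path continuity, so the
germ σ-algebra is independent of all of `W`. Being itself contained in `σ(W)`, it is independent of
itself, hence trivial. -/

namespace ProbabilityTheory

/-- Finite linear combinations of the values of a Gaussian process form a Gaussian process. -/
lemma IsGaussianProcess.of_finite_linear_combination {S T Ω : Type*} {mΩ : MeasurableSpace Ω}
    {P : Measure Ω} {X : T → Ω → ℝ} {Y : S → Ω → ℝ} (hX : IsGaussianProcess X P)
    (h : ∀ s, ∃ (n : ℕ) (c : Fin n → ℝ) (f : Fin n → T), ∀ ω, Y s ω = ∑ k, c k * X (f k) ω) :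
    IsGaussianProcess Y P := by
  classical
  refine hX.of_isGaussianProcess fun s ↦ ?_
  obtain ⟨n, c, f, hY⟩ := h s
  refine ⟨Finset.univ.image f,
    ∑ k, c k • ContinuousLinearMap.proj (R := ℝ) (φ := fun _ : Finset.univ.image f ↦ ℝ)
      ⟨f k, Finset.mem_image_of_mem f (Finset.mem_univ k)⟩, fun ω ↦ ?_⟩
  simp [hY]

/-- If `m` is contained, for each `n`, in a σ-algebra independent of the process `Y n`, and if
`Y n` converges almost surely to `X` pointwise, then `m` is independent of the process `X`. -/
lemma indep_comap_process_of_tendsto {T Ω : Type*} {m mΩ : MeasurableSpace Ω} {P : Measure Ω}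
    [IsProbabilityMeasure P] (hm : m ≤ mΩ) {X : T → Ω → ℝ}
    {Y : ℕ → T → Ω → ℝ} (hX : ∀ t, Measurable (X t)) (hY : ∀ n t, Measurable (Y n t))
    (hind : ∀ n, Indep (MeasurableSpace.comap (fun ω t ↦ Y n t ω) MeasurableSpace.pi) m P)
    (hlim : ∀ t, ∀ᵐ ω ∂P, Filter.Tendsto (fun n ↦ Y n t ω) Filter.atTop (nhds (X t ω))) :
    Indep m (MeasurableSpace.comap (fun ω t ↦ X t ω) MeasurableSpace.pi) P := by
  refine indep_comap_process_of_bcf hm (fun t ↦ (hX t).aemeasurable) fun A hA I f ↦ ?_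
  have hprod (n : ℕ) : ∫ ω in A, f (fun i : I ↦ Y n i ω) ∂P =
      P.real A * ∫ ω, f (fun i : I ↦ Y n i ω) ∂P := by
    have hcomap : Measurable[MeasurableSpace.comap (fun ω t ↦ Y n t ω) MeasurableSpace.pi]
        fun ω (i : I) ↦ Y n i ω :=
      (measurable_pi_lambda (fun (g : T → ℝ) (i : I) ↦ g i)
        fun i ↦ measurable_pi_apply (i : T)).comp (comap_measurable _)
    have hmeas : StronglyMeasurable[MeasurableSpace.comap (fun ω t ↦ Y n t ω) MeasurableSpace.pi]
        fun ω ↦ f (fun i : I ↦ Y n i ω) :=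
      f.continuous.stronglyMeasurable.comp_measurable hcomap
    have hle : MeasurableSpace.comap (fun ω t ↦ Y n t ω) MeasurableSpace.pi ≤ mΩ :=
      (measurable_pi_lambda _ (hY n)).comap_le
    have hint : Integrable (fun ω ↦ f (fun i : I ↦ Y n i ω)) P :=
      .of_bound (hmeas.mono hle).aestronglyMeasurable ‖f‖ (ae_of_all _ fun _ ↦ f.norm_coe_le_norm _)
    -- By independence the conditional expectation given `m` is the constant mean.
    rw [← setIntegral_condExp hm hint hA,
      setIntegral_congr_ae (hm A hA)
        ((condExp_indep_eq hle hm hmeas (hind n)).mono fun _ h _ ↦ h)]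
    simp
  have hconv : ∀ᵐ ω ∂P, Filter.Tendsto (fun n ↦ f (fun i : I ↦ Y n i ω)) Filter.atTop
      (nhds (f (fun i : I ↦ X i ω))) := by
    filter_upwards [ae_all_iff.2 fun i : I ↦ hlim i] with ω hω
    exact (f.continuous.tendsto _).comp (tendsto_pi_nhds.2 hω)
  have hdom (μ : Measure Ω) [IsFiniteMeasure μ] (hμ : ∀ᵐ ω ∂μ,
      Filter.Tendsto (fun n ↦ f (fun i : I ↦ Y n i ω)) Filter.atTop
        (nhds (f (fun i : I ↦ X i ω)))) :
      Filter.Tendsto (fun n ↦ ∫ ω, f (fun i : I ↦ Y n i ω) ∂μ) Filter.atTop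
        (nhds (∫ ω, f (fun i : I ↦ X i ω) ∂μ)) :=
    tendsto_integral_of_dominated_convergence (fun _ ↦ ‖f‖)
      (fun n ↦ (f.continuous.measurable.comp
        (measurable_pi_lambda _ fun i ↦ hY n i)).aestronglyMeasurable)
      (integrable_const _) (fun n ↦ ae_of_all _ fun _ ↦ f.norm_coe_le_norm _) hμ
  refine tendsto_nhds_unique (hdom (P.restrict A) (ae_restrict_of_ae hconv)) ?_
  simp_rw [hprod]
  exact (hdom P hconv).const_mul _

end ProbabilityTheory

namespace BrownianSheet

/-- The endpoints of the intervals in `1_[0,a] - 1_[0,a ∧ (s+δ)] + 1_[0,a ∧ (s-δ)]`, which is the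
indicator of `[0,a]` with the `δ`-neighbourhood of `s` removed. -/
def puncturedEndpoint (s δ a : ℝ≥0) : Fin 3 → ℝ≥0 := ![a, min a (s + δ), min a (s - δ)]

/-- The coefficients of the three indicators described in `puncturedEndpoint`. -/
def puncturedSign : Fin 3 → ℝ := ![1, -1, 1]

/-- The sum is the length of `[0,x]` inside the punctured `[0,a]`. Moving `x` within the removed
neighbourhood does not change it. Truncated subtraction covers `δ > s`. -/
lemma sum_puncturedSign_mul_min {s δ a x : ℝ≥0} (hx : |(s : ℝ) - x| < δ) :
    ∑ i, puncturedSign i * min (puncturedEndpoint s δ a i : ℝ) x = min (a : ℝ) ↑(s - δ) := by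
  obtain ⟨h₁, h₂⟩ := abs_lt.1 hx
  have hle : x ≤ s + δ := by
    rw [← NNReal.coe_le_coe]; push_cast; linarith
  have hge : s - δ ≤ x := by
    rw [tsub_le_iff_right, ← NNReal.coe_le_coe]; push_cast; linarith
  have e₁ : min (min a (s + δ)) x = min a x := by rw [min_assoc, min_eq_right hle]
  have e₂ : min (min a (s - δ)) x = min a (s - δ) := by rw [min_assoc, min_eq_left hge]
  simp only [Fin.sum_univ_three, puncturedSign, puncturedEndpoint, Matrix.cons_val_zero,
    Matrix.cons_val_one, Matrix.cons_val, ← NNReal.coe_min, e₁, e₂]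
  ring

/-- The white noise of the rectangle `[0,p]` from which the strips of half-width `δ` around the
vertical and the horizontal line through `(s,t)` have been removed. -/
def puncturedSheet {Ω : Type*} (W : ℝ≥0 × ℝ≥0 → Ω → ℝ) (s t δ : ℝ≥0) (p : ℝ≥0 × ℝ≥0) (ω : Ω) : ℝ :=
  ∑ k : Fin 3 × Fin 3, puncturedSign k.1 * puncturedSign k.2 *
    W (puncturedEndpoint s δ p.1 k.1, puncturedEndpoint t δ p.2 k.2) ω

lemma incrementSigma_eq_comap {Ω : Type*} (W : ℝ≥0 × ℝ≥0 → Ω → ℝ) (s t : ℝ≥0) (ε : ℝ) :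
    incrementSigma W s t ε = MeasurableSpace.comap
      (fun ω (q : {q : ℝ≥0 × ℝ≥0 // max |(s : ℝ) - q.1| |(t : ℝ) - q.2| < ε}) ↦
        W q ω - W (s, t) ω) MeasurableSpace.pi := by
  rw [MeasurableSpace.pi, MeasurableSpace.comap_iSup]
  simp_rw [MeasurableSpace.comap_comp]
  rfl

lemma incrementSigma_le_comap {Ω : Type*} (W : ℝ≥0 × ℝ≥0 → Ω → ℝ) (s t : ℝ≥0) (ε : ℝ) :
    incrementSigma W s t ε ≤ MeasurableSpace.comap (fun ω p ↦ W p ω) MeasurableSpace.pi := by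
  refine iSup_le fun q ↦ Measurable.comap_le ?_
  have hdiff : Measurable fun f : ℝ≥0 × ℝ≥0 → ℝ ↦ f q - f (s, t) :=
    (measurable_pi_apply _).sub (measurable_pi_apply _)
  exact hdiff.comp (comap_measurable _)

lemma tendsto_puncturedSheet {Ω : Type*} {w : ℝ≥0 × ℝ≥0 → Ω → ℝ} {ω : Ω} (hw : Continuous fun p ↦ w p ω)
    (s t : ℝ≥0) (p : ℝ≥0 × ℝ≥0) :
    Filter.Tendsto (fun δ ↦ puncturedSheet w s t δ p ω) (nhds 0) (nhds (w p ω)) := by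
  have hcont : Continuous fun δ ↦ puncturedSheet w s t δ p ω := by
    have hend (r a : ℝ≥0) (i : Fin 3) : Continuous fun δ ↦ puncturedEndpoint r δ a i := by
      fin_cases i <;> simp only [puncturedEndpoint, Fin.reduceFinMk, Fin.zero_eta, Fin.mk_one,
        Matrix.cons_val_zero, Matrix.cons_val_one, Matrix.cons_val] <;> fun_prop
    exact continuous_finsetSum _ fun k _ ↦
      (hw.comp ((hend s p.1 k.1).prodMk (hend t p.2 k.2))).const_mul _
  -- At `δ = 0` the last two endpoints coincide and their terms cancel.
  convert hcont.tendsto 0 using 2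
  simp [puncturedSheet, Fintype.sum_prod_type, Fin.sum_univ_three, puncturedSign,
    puncturedEndpoint]

variable {Ω : Type*} [MeasurableSpace Ω] {P : Measure Ω} {W : ℝ≥0 × ℝ≥0 → Ω → ℝ}

lemma measurable_puncturedSheet (hW : IsBrownianSheet W P) (s t δ : ℝ≥0) (p : ℝ≥0 × ℝ≥0) :
    Measurable (puncturedSheet W s t δ p) :=
  Finset.measurable_fun_sum _ fun _ _ ↦ (hW.measurable _).const_mul _

lemma memLp_two (hW : IsBrownianSheet W P) (p : ℝ≥0 × ℝ≥0) : MemLp (W p) 2 P :=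
  (hW.isGaussianProcess.hasGaussianLaw_eval p).memLp_two

/-- The covariance factors over the two coordinates. What matters is that the value does not depend
on `q`. -/
lemma covariance_puncturedSheet (hW : IsBrownianSheet W P) {s t δ : ℝ≥0} (p : ℝ≥0 × ℝ≥0)
    {q : ℝ≥0 × ℝ≥0} (hq₁ : |(s : ℝ) - q.1| < δ) (hq₂ : |(t : ℝ) - q.2| < δ) :
    cov[puncturedSheet W s t δ p, W q; P] = min (p.1 : ℝ) ↑(s - δ) * min (p.2 : ℝ) ↑(t - δ) := by
  have := hW.isGaussianProcess.isProbabilityMeasure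
  unfold puncturedSheet
  rw [covariance_fun_sum_left (fun k ↦ (memLp_two hW _).const_mul _) (memLp_two hW q)]
  simp_rw [covariance_const_mul_left, hW.covariance_eq]
  rw [← sum_puncturedSign_mul_min hq₁, ← sum_puncturedSign_mul_min hq₂, Finset.sum_mul_sum,
    Fintype.sum_prod_type]
  exact Finset.sum_congr rfl fun i _ ↦ Finset.sum_congr rfl fun j _ ↦ by ring

lemma memLp_puncturedSheet (hW : IsBrownianSheet W P) (s t δ : ℝ≥0) (p : ℝ≥0 × ℝ≥0) :
    MemLp (puncturedSheet W s t δ p) 2 P :=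
  memLp_finsetSum _ fun _ _ ↦ (memLp_two hW _).const_mul _

lemma indep_puncturedSheet_incrementSigma (hW : IsBrownianSheet W P) (s t : ℝ≥0) {δ : ℝ≥0}
    (hδ : 0 < δ) :
    Indep (MeasurableSpace.comap (fun ω p ↦ puncturedSheet W s t δ p ω) MeasurableSpace.pi)
      (incrementSigma W s t δ) P := by
  have := hW.isGaussianProcess.isProbabilityMeasure
  rw [incrementSigma_eq_comap]
  refine IsGaussianProcess.indepFun_of_covariance_eq_zero (X := puncturedSheet W s t δ)
    (Y := fun (q : {q : ℝ≥0 × ℝ≥0 // max |(s : ℝ) - q.1| |(t : ℝ) - q.2| < δ}) ω ↦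
      W q ω - W (s, t) ω) ?_ (fun p ↦ (measurable_puncturedSheet hW s t δ p).aemeasurable)
    (fun q ↦ ((hW.measurable _).sub (hW.measurable _)).aemeasurable) fun p q ↦ ?_
  · refine hW.isGaussianProcess.of_finite_linear_combination ?_
    rintro (p | q)
    · refine ⟨_, fun k ↦ puncturedSign (finProdFinEquiv.symm k).1 *
          puncturedSign (finProdFinEquiv.symm k).2,
        fun k ↦ (puncturedEndpoint s δ p.1 (finProdFinEquiv.symm k).1,
          puncturedEndpoint t δ p.2 (finProdFinEquiv.symm k).2), fun ω ↦ ?_⟩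
      exact (Equiv.sum_comp finProdFinEquiv.symm fun k : Fin 3 × Fin 3 ↦
        puncturedSign k.1 * puncturedSign k.2 *
          W (puncturedEndpoint s δ p.1 k.1, puncturedEndpoint t δ p.2 k.2) ω).symm
    · exact ⟨2, ![1, -1], ![q, (s, t)], fun ω ↦ by simp [sub_eq_add_neg]⟩
  · have hq := max_lt_iff.1 q.2
    -- The centre `(s,t)` also lies in the window, so both covariances are the same constant.
    rw [covariance_fun_sub_right (memLp_puncturedSheet hW s t δ p) (memLp_two hW _)
      (memLp_two hW _), covariance_puncturedSheet hW p hq.1 hq.2,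
      covariance_puncturedSheet hW p (by simpa) (by simpa), sub_self]

/-- The germ σ-algebra at a point is independent of the whole Brownian sheet. -/
lemma indep_germSigma_comap [IsProbabilityMeasure P] (hW : IsBrownianSheet W P) (s t : ℝ≥0) :
    Indep (germSigma W s t) (MeasurableSpace.comap (fun ω p ↦ W p ω) MeasurableSpace.pi) P := by
  have hle (ε : ℚ) (hε : 0 < ε) : germSigma W s t ≤ incrementSigma W s t (ε : ℝ) :=
    iInf_le (fun ε : {ε : ℚ // 0 < ε} ↦ incrementSigma W s t ((ε : ℚ) : ℝ)) ⟨ε, hε⟩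
  refine indep_comap_process_of_tendsto
    (Y := fun n ↦ puncturedSheet W s t (1 / ((n : ℝ≥0) + 1)))
    ((hle 1 one_pos).trans ((incrementSigma_le_comap W s t _).trans
      (measurable_pi_lambda _ hW.measurable).comap_le))
    hW.measurable (fun n p ↦ measurable_puncturedSheet hW s t _ p) (fun n ↦ ?_) fun p ↦ ?_
  · refine indep_of_indep_of_le_right
      (indep_puncturedSheet_incrementSigma hW s t (by positivity)) ?_
    -- The widths `1 / (n + 1)` are rational, so they occur in the germ intersection.
    simpa using hle (1 / ((n : ℚ) + 1)) (by positivity)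
  · filter_upwards [hW.continuous_paths] with ω hω
    exact (tendsto_puncturedSheet hω s t p).comp tendsto_one_div_add_atTop_nhds_zero_nat

end BrownianSheet

theorem lemma8p4 {Ω : Type*} [MeasurableSpace Ω] (P : Measure Ω) [IsProbabilityMeasure P]
    (W : ℝ≥0 × ℝ≥0 → Ω → ℝ) (hW : BrownianSheet.IsBrownianSheet W P)
    (s t : ℝ≥0) (hs : 0 < s) (ht : 0 < t) (A : Set Ω)
    (hA : MeasurableSet[BrownianSheet.germSigma W s t] A) :
    P A = 0 ∨ P A = 1 := by
  have hle : BrownianSheet.germSigma W s t ≤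
      MeasurableSpace.comap (fun ω p ↦ W p ω) MeasurableSpace.pi :=
    (iInf_le _ ⟨1, one_pos⟩).trans (BrownianSheet.incrementSigma_le_comap W s t _)
  exact measure_eq_zero_or_one_of_indepSet_self
    ((BrownianSheet.indep_germSigma_comap hW s t).indepSet_of_measurableSet hA (hle A hA))
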